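/- Let $1\le p<\infty$, and let $(X,d)$ be a connected, proper metric space with a Borel-regular measure $\mu$ such that $\mu(X)=\infty$ and $0<\mu(B(x,r))<\infty$ for all $x\in X$ and $r\in(0,\infty)$. A Borel function $g:X\to[0,\infty]$ is an upper gradient of $u:X\to\mathbb R$ if $|u(x)-u(y)|\le\int_\gamma g\,ds$ for every compact rectifiable curve $\gamma$ with endpoints $x,y$. The class $D^{1,p}(X)$ consists of the $\mu$-measurable functions $u:X\to\mathbb R$ that have an upper gradient $g$ with $\int_X g^p\,d\mu<\infty$, and $N^{1,p}(X)=\{u\in D^{1,p}(X):\int_X|u|^p\,d\mu<\infty\}$. The $p$-modulus of a family $\Gamma$ of locally rectifiable curves is $\mathrm{Mod}_p(\Gamma)=\inf_\rho\int_X\rho^p\,d\mu$, where $\rho$ ranges over the Borel functions $\rho:X\to[0,\infty]$ with $\int_\gamma\rho\,ds\ge1$ for all $\gamma\in\Gamma$. A set $K\subset X$ is $p$-exceptional if the family of non-constant locally rectifiable curves that meet $K$ has zero $p$-modulus. An end at infinity of $X$ is a sequence $(F_j)_{j\ge1}$ of subsets of $X$, with associated compact sets $K_j\subset X$, such that each $F_j$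 is an unbounded connected component of $X\setminus K_j$, $\overline{F_{j+1}}\subset F_j$ and $\mathrm{dist}(X\setminus F_j,F_{j+1})>0$ for all $j$, and $\bigcap_jF_j=\emptyset$. Let $\Gamma_j$ be the family of locally rectifiable curves $\gamma:[0,\infty)\to X$ with $\gamma(0)\in K_1$ and $\gamma((\tau,\infty))\subset F_j$ for some $\tau>0$. The end is $p$-hyperbolic if $\lim_{j\to\infty}\mathrm{Mod}_p(\Gamma_j)>0$, and $p$-parabolic otherwise. Suppose that $X$ is of uniformly locally $p$-controlled geometry: there are $0<R_0\le\infty$, $C_d\ge1$ and $C,\lambda>0$ such that for all $x\in X$ and $0<r<R_0$ we have $\mu(B(x,2r))\le C_d\,\mu(B(x,r))$, and $$\frac1{\mu(B(x,r))}\int_{B(x,r)}|u-u_{B(x,r)}|\,d\mu\le C\,r\left(\frac1{\mu(B(x,\lambda r))}\int_{B(x,\lambda r)}g^p\,d\mu\right)^{1/p}$$ for every $u\in L^1_{\mathrm{loc}}(X)$ and every upper gradient $g$ of $u$, where $u_{B(x,r)}$ is the mean of $u$ over $B(x,r)$. Suppose also that $X$ is a length space and that $\inf_{x\in X}\mu(B(x,1))>0$.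 If $X$ has a $p$-parabolic end $(F_j)_j$ whose associated compact set $K_1$ is not $p$-exceptional, then $D^{1,p}(X)\ne N^{1,p}(X)+\mathbb R$, where $\mathbb R$ denotes the constant functions. -/

import Mathlib

open Set Filter Topology MeasureTheory
open scoped ENNReal NNReal Pointwise

noncomputable section

namespace NewtonSobolev

variable {X : Type*} [MetricSpace X]

/-- `γ` restricted to `[a, b]` is a compact rectifiable curve. -/
structure IsRectifiableCurve (γ : ℝ → X) (a b : ℝ) : Prop where
  le : a ≤ b
  continuousOn : ContinuousOn γ (Icc a b)
  rectifiable : BoundedVariationOn γ (Icc a b)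

/-- `∫_γ ρ ds` along `γ : [a, b] → X`: the integral over `[0, ℓ(γ)]` of `ρ` composed with the
arc-length parametrization of `γ`. -/
def lineIntegral (ρ : X → ℝ≥0∞) (γ : ℝ → X) (a b : ℝ) : ℝ≥0∞ :=
  ∫⁻ t in Icc 0 (eVariationOn γ (Icc a b)).toReal, ρ (naturalParameterization γ (Icc a b) a t)

/-- `γ` restricted to `[0, ∞)` is a locally rectifiable curve. Compact rectifiable curves are
included, as the curves that are eventually constant. -/
structure IsLocallyRectifiableRay (γ : ℝ → X) : Prop where
  continuousOn : ContinuousOn γ (Ici 0)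
  rectifiable : LocallyBoundedVariationOn γ (Ici 0)

/-- `∫_γ ρ ds` along a locally rectifiable `γ : [0, ∞) → X`: the supremum of the integrals over
compact subcurves. -/
def rayIntegral (ρ : X → ℝ≥0∞) (γ : ℝ → X) : ℝ≥0∞ :=
  ⨆ T : ℝ≥0, lineIntegral ρ γ 0 T

/-- Every two points are joined by curves of length arbitrarily close to their distance. -/
def IsLengthSpace (X : Type*) [MetricSpace X] : Prop :=
  ∀ x y : X, ∀ ε : ℝ, 0 < ε → ∃ γ : ℝ → X,
    ContinuousOn γ (Icc 0 1) ∧ γ 0 = x ∧ γ 1 = y ∧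
      eVariationOn γ (Icc 0 1) ≤ ENNReal.ofReal (dist x y + ε)

variable [MeasurableSpace X]

/-- `g` is an upper gradient of `u`. (Constant curves impose no condition.) -/
def IsUpperGradient (u : X → ℝ) (g : X → ℝ≥0∞) : Prop :=
  Measurable g ∧ ∀ (γ : ℝ → X) (a b : ℝ), IsRectifiableCurve γ a b →
    ‖u (γ b) - u (γ a)‖ₑ ≤ lineIntegral g γ a b

/-- The Dirichlet class `D^{1,p}(X)`, of pointwise defined functions that are measurable with
respect to the completion of `μ`. -/
def dirichletClass (μ : Measure X) (p : ℝ) : Set (X → ℝ) :=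
  {u | AEMeasurable u μ ∧ ∃ g : X → ℝ≥0∞, IsUpperGradient u g ∧ ∫⁻ x, g x ^ p ∂μ < ∞}

/-- The Newton-Sobolev class `N^{1,p}(X)`. -/
def newtonClass (μ : Measure X) (p : ℝ) : Set (X → ℝ) :=
  {u | u ∈ dirichletClass μ p ∧ ∫⁻ x, ‖u x‖ₑ ^ p ∂μ < ∞}

/-- Uniformly local doubling together with a uniformly local `p`-Poincaré inequality. -/
def UniformlyLocallyControlled (μ : Measure X) (p : ℝ) : Prop :=
  ∃ (R₀ : ℝ≥0∞) (Cd : ℝ≥0) (C lam : ℝ), 0 < R₀ ∧ 1 ≤ Cd ∧ 0 < C ∧ 0 < lam ∧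
    ∀ (x : X) (r : ℝ), 0 < r → ENNReal.ofReal r < R₀ →
      μ (Metric.ball x (2 * r)) ≤ Cd * μ (Metric.ball x r) ∧
      ∀ (u : X → ℝ) (g : X → ℝ≥0∞), LocallyIntegrable u μ → IsUpperGradient u g →
        ⨍⁻ y in Metric.ball x r, ‖u y - ⨍ z in Metric.ball x r, u z ∂μ‖ₑ ∂μ ≤
          ENNReal.ofReal (C * r) * (⨍⁻ y in Metric.ball x (lam * r), g y ^ p ∂μ) ^ (1 / p)

/-- The `p`-modulus of a family of locally rectifiable curves `[0, ∞) → X`. -/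
def modulus (μ : Measure X) (p : ℝ) (Γ : Set (ℝ → X)) : ℝ≥0∞ :=
  ⨅ (ρ : X → ℝ≥0∞) (_ : Measurable ρ) (_ : ∀ γ ∈ Γ, 1 ≤ rayIntegral ρ γ), ∫⁻ x, ρ x ^ p ∂μ

/-- `K` is `p`-exceptional: `p`-almost no non-constant curve meets it. -/
def IsExceptional (μ : Measure X) (p : ℝ) (K : Set X) : Prop :=
  modulus μ p {γ | IsLocallyRectifiableRay γ ∧ (γ '' Ici 0).Nontrivial ∧
    ((γ '' Ici 0) ∩ K).Nonempty} = 0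

/-- `F` is an end at infinity, with associated compact sets `K`. The second condition says
`dist (X \ F j, F (j + 1)) > 0`. -/
structure IsEnd (F K : ℕ → Set X) : Prop where
  closure_subset : ∀ j, closure (F (j + 1)) ⊆ F j
  separated : ∀ j, ∃ δ : ℝ, 0 < δ ∧ ∀ x ∉ F j, ∀ y ∈ F (j + 1), δ ≤ dist x y
  iInter_eq : ⋂ j, F j = ∅
  isCompact : ∀ j, IsCompact (K j)
  component : ∀ j, ∃ x ∈ (K j)ᶜ, F j = connectedComponentIn (K j)ᶜ x
  unbounded : ∀ j, ¬ Bornology.IsBounded (F j)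

/-- The locally rectifiable curves that start in `K` and are eventually in `F`. -/
def curvesToward (K F : Set X) : Set (ℝ → X) :=
  {γ | IsLocallyRectifiableRay γ ∧ γ 0 ∈ K ∧ ∃ τ : ℝ, 0 < τ ∧ γ '' Ioi τ ⊆ F}

/-- The end `F`, with associated compact sets `K`, is `p`-hyperbolic. -/
def IsHyperbolicEnd (μ : Measure X) (p : ℝ) (F K : ℕ → Set X) : Prop :=
  ∃ L : ℝ≥0∞, 0 < L ∧ Tendsto (fun j => modulus μ p (curvesToward (K 0) (F j))) atTop (𝓝 L)

/-- The end `F`, with associated compact sets `K`, is `p`-parabolic. -/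
def IsParabolicEnd (μ : Measure X) (p : ℝ) (F K : ℕ → Set X) : Prop :=
  ¬ IsHyperbolicEnd μ p F K

end NewtonSobolev

end

/-!
Parabolicity of the end yields a lower semicontinuous density `σ ∈ L^p` for which the `σ`-length of
every curve from `K` to `F k` is at least `M` once `k` is large. Let `U x` be the infimum of the
`σ`-lengths of the curves from `K` to `x`; it is measurable, since by the Arzelà–Ascoli theorem and
lower semicontinuity its sublevel sets are countable unions of compact sets.

Along a curve of finite `σ`-length `U` is either everywhere finite or everywhere infinite, so the
indicator of `{U = ∞}` has the upper gradient `ε σ` for every `ε > 0`. By the Poincaré inequality it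
is a.e. constant on small balls, hence a.e. constant by connectedness. If `U = ∞` a.e., then almost
no non-constant curve meets `K`, because `U` vanishes on `K` and hence is finite along every curve
of finite `σ`-length through `K`; so `K` would be exceptional.

Thus `U < ∞` a.e., and `U` belongs to the Dirichlet class with upper gradient `σ`. But `U ≥ M` on
some `F k`, a set that contains infinitely many disjoint unit balls and so has infinite measure;
hence `U - c` is not in `L^p` for any constant `c`.
-/

namespace NewtonSobolev

section RealLine

variable {E : Type*} [PseudoEMetricSpace E] {C : ℝ≥0} {f g : ℝ → E}

theorem lipschitzOnWith_iff_edist_le_ofReal_mul_sub {s : Set ℝ} :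
    LipschitzOnWith C f s ↔
      ∀ x ∈ s, ∀ y ∈ s, x ≤ y → edist (f x) (f y) ≤ ENNReal.ofReal (C * (y - x)) := by
  have mul_edist : ∀ x y : ℝ, x ≤ y → C * edist x y = ENNReal.ofReal (C * (y - x)) := by
    intro x y hxy
    rw [edist_comm, edist_dist, Real.dist_eq, abs_of_nonneg (sub_nonneg.2 hxy),
      ENNReal.ofReal_mul C.coe_nonneg, ENNReal.ofReal_coe_nnreal]
  constructor
  · intro hf x hx y hy hxy
    exact (hf hx hy).trans_eq (mul_edist x y hxy)
  · intro h x hx y hy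
    rcases le_total x y with hxy | hyx
    · exact (h x hx y hy hxy).trans_eq (mul_edist x y hxy).symm
    · rw [edist_comm, edist_comm x]
      exact (h y hy x hx hyx).trans_eq (mul_edist y x hyx).symm

theorem lipschitzWith_ite_le {a : ℝ} (hf : LipschitzWith C f) (hg : LipschitzWith C g)
    (h : f a = g a) : LipschitzWith C fun t => if t ≤ a then f t else g t := by
  rw [← lipschitzOnWith_univ, lipschitzOnWith_iff_edist_le_ofReal_mul_sub] at *
  intro x _ y _ hxy
  split_ifs with hx hy hy
  · exact hf x trivial y trivial hxy
  · have hay := (not_le.1 hy).le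
    calc edist (f x) (g y) ≤ edist (f x) (f a) + edist (g a) (g y) :=
          h ▸ edist_triangle _ _ _
      _ ≤ ENNReal.ofReal (C * (a - x)) + ENNReal.ofReal (C * (y - a)) :=
          add_le_add (hf x trivial a trivial hx) (hg a trivial y trivial hay)
      _ = ENNReal.ofReal (C * (y - x)) := by
          rw [← ENNReal.ofReal_add (mul_nonneg C.coe_nonneg (sub_nonneg.2 hx))
            (mul_nonneg C.coe_nonneg (sub_nonneg.2 hay)), ← mul_add, sub_add_sub_cancel']
  · exact absurd (hxy.trans hy) hx
  · exact hg x trivial y trivial hxy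

theorem lipschitzOnWith_of_hasConstantSpeedOnWith {s : Set ℝ}
    (h : HasConstantSpeedOnWith f s C) : LipschitzOnWith C f s :=
  lipschitzOnWith_iff_edist_le_ofReal_mul_sub.2 fun x hx y hy hxy =>
    (eVariationOn.edist_le f (s := s ∩ Icc x y) ⟨hx, le_rfl, hxy⟩ ⟨hy, hxy, le_rfl⟩).trans_eq
      (h hx hy)

theorem lipschitzOnWith_variationOnFromTo {s : Set ℝ} {a : ℝ} (ha : a ∈ s)
    (hf : LipschitzOnWith C f s) : LipschitzOnWith C (variationOnFromTo f s a) s := by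
  refine lipschitzOnWith_iff_edist_le_ofReal_mul_sub.2 fun x hx y hy hxy => ?_
  have variation_le : eVariationOn f (s ∩ Icc x y) ≤ ENNReal.ofReal (C * (y - x)) :=
    calc eVariationOn (f ∘ id) (s ∩ Icc x y)
        ≤ C * eVariationOn (id : ℝ → ℝ) (s ∩ Icc x y) :=
          hf.comp_eVariationOn_le fun _ ht => ht.1
      _ ≤ C * eVariationOn (id : ℝ → ℝ) (Icc x y) := by
          gcongr
          exact eVariationOn.mono _ inter_subset_right
      _ = ENNReal.ofReal (C * (y - x)) := by
          rw [eVariationOn_id_Icc, ENNReal.ofReal_mul C.coe_nonneg, ENNReal.ofReal_coe_nnreal]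
  rw [edist_comm, edist_dist, Real.dist_eq,
    variationOnFromTo.sub_right hf.locallyBoundedVariationOn ha hy hx,
    abs_of_nonneg (variationOnFromTo.nonneg_of_le _ _ hxy), variationOnFromTo.eq_of_le _ _ hxy]
  exact ENNReal.ofReal_toReal_le.trans variation_le

theorem setLIntegral_Icc_comp_sub_const (φ : ℝ → ℝ≥0∞) (c a b : ℝ) :
    ∫⁻ t in Icc a b, φ (t - c) = ∫⁻ t in Icc (a - c) (b - c), φ t := by
  have h := (measurePreserving_sub_right volume c).setLIntegral_comp_emb
    (MeasurableEquiv.subRight c).measurableEmbedding φ (Icc a b)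
  simpa using h

theorem setLIntegral_Icc_comp_neg (φ : ℝ → ℝ≥0∞) (a b : ℝ) :
    ∫⁻ t in Icc a b, φ (-t) = ∫⁻ t in Icc (-b) (-a), φ t := by
  have h := (Measure.measurePreserving_neg volume).setLIntegral_comp_emb
    (MeasurableEquiv.neg ℝ).measurableEmbedding φ (Icc a b)
  simpa using h

end RealLine

theorem lowerSemicontinuous_lintegral {Z α : Type*} [TopologicalSpace Z]
    [FirstCountableTopology Z] [MeasurableSpace α] {μ : Measure α} {f : Z → α → ℝ≥0∞}
    (hf : ∀ z, Measurable (f z)) (hlsc : ∀ a, LowerSemicontinuous fun z => f z a) :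
    LowerSemicontinuous fun z => ∫⁻ a, f z a ∂μ :=
  lowerSemicontinuous_iff_le_liminf.2 fun z =>
    calc ∫⁻ a, f z a ∂μ ≤ ∫⁻ a, liminf (fun w => f w a) (𝓝 z) ∂μ :=
          lintegral_mono fun a => (hlsc a).le_liminf z
      _ ≤ liminf (fun w => ∫⁻ a, f w a ∂μ) (𝓝 z) := lintegral_liminf_le hf

theorem lowerSemicontinuous_indicator_of_isOpen {Z β : Type*} [TopologicalSpace Z] [Preorder β]
    [Zero β] {S : Set Z} (hS : IsOpen S) {f : Z → β} (hf : LowerSemicontinuous f) (h0 : 0 ≤ f) :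
    LowerSemicontinuous (S.indicator f) := by
  intro z r hr
  by_cases hz : z ∈ S
  · rw [indicator_of_mem hz] at hr
    filter_upwards [hS.mem_nhds hz, hf z r hr] with w hw hrw
    rwa [indicator_of_mem hw]
  · rw [indicator_of_notMem hz] at hr
    exact Eventually.of_forall fun w => hr.trans_le (indicator_apply_nonneg fun _ => h0 w)

theorem lintegral_const_mul_rpow {α : Type*} [MeasurableSpace α] {μ : Measure α} {p : ℝ}
    (hp : 0 ≤ p) {c : ℝ≥0∞} (hc : c ≠ ∞) (f : α → ℝ≥0∞) :
    ∫⁻ x, (c * f x) ^ p ∂μ = c ^ p * ∫⁻ x, f x ^ p ∂μ := by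
  simp only [ENNReal.mul_rpow_of_nonneg _ _ hp]
  exact lintegral_const_mul' _ _ (ENNReal.rpow_ne_top_of_nonneg hp hc)

theorem exists_lowerSemicontinuous_ge_lintegral_rpow_lt_top {X : Type*} [TopologicalSpace X]
    [MeasurableSpace X] [BorelSpace X] {μ : Measure X} [μ.WeaklyRegular] {p : ℝ} (hp : 0 < p)
    {ρ : ℕ → X → ℝ≥0∞} (hρ : ∀ n, Measurable (ρ n))
    (hint : ∑' n, ∫⁻ x, ρ n x ^ p ∂μ ≠ ∞) :
    ∃ σ : X → ℝ≥0∞, LowerSemicontinuous σ ∧ (∀ n, ρ n ≤ σ) ∧ ∫⁻ x, σ x ^ p ∂μ < ∞ := by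
  have hρp : ∀ n, Measurable fun x => ρ n x ^ p := fun n => (hρ n).pow_const p
  obtain ⟨g, hle, hlsc, hg⟩ := exists_le_lowerSemicontinuous_lintegral_ge μ
    (fun x => ∑' n, ρ n x ^ p) (.tsum hρp) one_ne_zero
  refine ⟨fun x => g x ^ p⁻¹, ?_, fun n x => ?_, ?_⟩
  · exact ENNReal.continuous_rpow_const.comp_lowerSemicontinuous hlsc
      (ENNReal.monotone_rpow_of_nonneg (inv_nonneg.2 hp.le))
  · exact (ENNReal.le_rpow_inv_iff hp).2 ((ENNReal.le_tsum n).trans (hle x))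
  · simp only [ENNReal.rpow_inv_rpow hp.ne']
    rw [lintegral_tsum fun n => (hρp n).aemeasurable] at hg
    exact hg.trans_lt (ENNReal.add_lt_top.2 ⟨hint.lt_top, ENNReal.one_lt_top⟩)

section Curves

variable {X : Type*} [MetricSpace X] {γ : ℝ → X} {a b : ℝ}

theorem isRectifiableCurve_of_lipschitzOnWith {C : ℝ≥0} (hab : a ≤ b)
    (hγ : LipschitzOnWith C γ (Icc a b)) : IsRectifiableCurve γ a b := by
  refine ⟨hab, hγ.continuousOn, ?_⟩
  have := hγ.locallyBoundedVariationOn a b ⟨le_rfl, hab⟩ ⟨hab, le_rfl⟩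
  rwa [inter_self] at this

theorem IsRectifiableCurve.continuousOn_variationOnFromTo (h : IsRectifiableCurve γ a b) :
    ContinuousOn (variationOnFromTo γ (Icc a b) a) (Icc a b) := by
  intro t ht
  have ha : a ∈ Icc a b := ⟨le_rfl, h.le⟩
  have hbv := h.rectifiable.locallyBoundedVariationOn
  have hγ := h.continuousOn t ht
  have left : ContinuousWithinAt (variationOnFromTo γ (Icc a b) a) (Icc a b ∩ Iio t) t := by
    simpa [ContinuousWithinAt] using variationOnFromTo.tendsto_left ha ht hbv
      (hγ.mono inter_subset_left)
  have right : ContinuousWithinAt (variationOnFromTo γ (Icc a b) a) (Icc a b ∩ Ioi t) t := by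
    simpa [ContinuousWithinAt] using variationOnFromTo.tendsto_right ha ht hbv
      (hγ.mono inter_subset_left)
  refine (left.union right).insert.mono fun s hs => ?_
  rcases lt_trichotomy s t with hst | rfl | hst
  · exact Or.inr (Or.inl ⟨hs, hst⟩)
  · exact Or.inl rfl
  · exact Or.inr (Or.inr ⟨hs, hst⟩)

theorem IsRectifiableCurve.image_variationOnFromTo (h : IsRectifiableCurve γ a b) :
    variationOnFromTo γ (Icc a b) a '' Icc a b = Icc 0 (eVariationOn γ (Icc a b)).toReal := by
  have mono := variationOnFromTo.monotoneOn h.rectifiable.locallyBoundedVariationOn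
    (left_mem_Icc.2 h.le)
  have right : variationOnFromTo γ (Icc a b) a b = (eVariationOn γ (Icc a b)).toReal := by
    rw [variationOnFromTo.eq_of_le _ _ h.le, inter_self]
  refine Subset.antisymm ?_ ?_
  · simpa [right, variationOnFromTo.self] using mono.image_Icc_subset
  · simpa [right, variationOnFromTo.self] using
      intermediate_value_Icc h.le h.continuousOn_variationOnFromTo

theorem IsRectifiableCurve.lipschitzOnWith_naturalParameterization
    (h : IsRectifiableCurve γ a b) :
    LipschitzOnWith 1 (naturalParameterization γ (Icc a b) a)
      (Icc 0 (eVariationOn γ (Icc a b)).toReal) := by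
  have := has_unit_speed_naturalParameterization γ h.rectifiable.locallyBoundedVariationOn
    (left_mem_Icc.2 h.le)
  rw [h.image_variationOnFromTo] at this
  exact lipschitzOnWith_of_hasConstantSpeedOnWith this

theorem IsRectifiableCurve.naturalParameterization_variationOnFromTo
    (h : IsRectifiableCurve γ a b) {t : ℝ} (ht : t ∈ Icc a b) :
    naturalParameterization γ (Icc a b) a (variationOnFromTo γ (Icc a b) a t) = γ t :=
  edist_eq_zero.1 <| edist_naturalParameterization_eq_zero
    h.rectifiable.locallyBoundedVariationOn (left_mem_Icc.2 h.le) ht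

theorem IsRectifiableCurve.exists_lipschitzWith_lineIntegral_eq (h : IsRectifiableCurve γ a b) :
    ∃ (L : ℝ≥0) (c : ℝ → X), LipschitzWith 1 c ∧ γ '' Icc a b ⊆ c '' Icc 0 (L : ℝ) ∧
      ∀ σ : X → ℝ≥0∞, lineIntegral σ γ a b = ∫⁻ t in Icc 0 (L : ℝ), σ (c t) := by
  set L := (eVariationOn γ (Icc a b)).toNNReal
  set n := naturalParameterization γ (Icc a b) a
  set c : ℝ → X := fun t => n (projIcc 0 (L : ℝ) L.coe_nonneg t)
  have c_eq : EqOn c n (Icc 0 (L : ℝ)) := fun t ht => by simp only [c, projIcc_of_mem _ ht]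
  refine ⟨L, c, ?_, ?_, fun σ => (setLIntegral_congr_fun measurableSet_Icc fun t ht => ?_).symm⟩
  · have := h.lipschitzOnWith_naturalParameterization.to_restrict.comp
      (LipschitzWith.projIcc L.coe_nonneg)
    rwa [mul_one] at this
  · rintro _ ⟨t, ht, rfl⟩
    have hv : variationOnFromTo γ (Icc a b) a t ∈ Icc 0 (L : ℝ) :=
      h.image_variationOnFromTo ▸ mem_image_of_mem _ ht
    exact ⟨_, hv, (c_eq hv).trans (h.naturalParameterization_variationOnFromTo ht)⟩
  · simp only [c_eq ht, n]

theorem lineIntegral_le_setLIntegral (σ : X → ℝ≥0∞) (hab : a ≤ b)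
    (hγ : LipschitzOnWith 1 γ (Icc a b)) :
    lineIntegral σ γ a b ≤ ∫⁻ t in Icc a b, σ (γ t) := by
  have h := isRectifiableCurve_of_lipschitzOnWith hab hγ
  set s := variationOnFromTo γ (Icc a b) a
  have hs : LipschitzOnWith 1 s (Icc a b) :=
    lipschitzOnWith_variationOnFromTo (left_mem_Icc.2 hab) hγ
  have hs_meas : AEMeasurable s (volume.restrict (Icc a b)) :=
    hs.continuousOn.aemeasurable measurableSet_Icc
  -- Maps of Lipschitz constant one do not increase the one-dimensional Hausdorff measure.
  have restrict_le_map : volume.restrict (Icc 0 (eVariationOn γ (Icc a b)).toReal) ≤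
      (volume.restrict (Icc a b)).map s := by
    refine Measure.le_iff.2 fun A hA => ?_
    rw [Measure.restrict_apply hA, Measure.map_apply_of_aemeasurable hs_meas hA,
      Measure.restrict_apply₀' measurableSet_Icc.nullMeasurableSet, ← h.image_variationOnFromTo,
      inter_comm, ← image_inter_preimage, inter_comm]
    simpa [hausdorffMeasure_real] using
      (hs.mono (inter_subset_right : s ⁻¹' A ∩ Icc a b ⊆ Icc a b)).hausdorffMeasure_image_le
        (d := 1) zero_le_one
  calc lineIntegral σ γ a b
      ≤ ∫⁻ t, σ (naturalParameterization γ (Icc a b) a t) ∂(volume.restrict (Icc a b)).map s :=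
        lintegral_mono' restrict_le_map le_rfl
    _ ≤ ∫⁻ t in Icc a b, σ (naturalParameterization γ (Icc a b) a (s t)) :=
        lintegral_map_le _ _
    _ = ∫⁻ t in Icc a b, σ (γ t) := setLIntegral_congr_fun measurableSet_Icc fun t ht => by
        simp only [s, h.naturalParameterization_variationOnFromTo ht]

theorem IsRectifiableCurve.lineIntegral_eq_of_eqOn_const (σ : X → ℝ≥0∞) {c : ℝ}
    (h : IsRectifiableCurve γ a c) (hab : a ≤ b) (hbc : b ≤ c)
    (hconst : EqOn γ (fun _ => γ b) (Icc b c)) :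
    lineIntegral σ γ a c = lineIntegral σ γ a b := by
  have hsub : Icc a b ⊆ Icc a c := Icc_subset_Icc_right hbc
  have h' : IsRectifiableCurve γ a b :=
    ⟨hab, h.continuousOn.mono hsub, h.rectifiable.mono hsub⟩
  have variation_eq : eVariationOn γ (Icc a c) = eVariationOn γ (Icc a b) := by
    have hbc_zero : eVariationOn γ (Icc b c) = 0 := by
      refine eVariationOn.constant_on ?_
      rw [hconst.image_eq]
      exact subsingleton_of_subset_singleton (image_subset_iff.2 fun _ _ => rfl)
    simpa [hbc_zero] using (eVariationOn.Icc_add_Icc γ hab hbc (mem_univ b)).symm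
  rw [lineIntegral, lineIntegral, variation_eq]
  refine setLIntegral_congr_fun measurableSet_Icc fun s hs => ?_
  rw [← h'.image_variationOnFromTo] at hs
  obtain ⟨t, ht, rfl⟩ := hs
  have variation_from_eq :
      variationOnFromTo γ (Icc a b) a t = variationOnFromTo γ (Icc a c) a t := by
    rw [variationOnFromTo.eq_of_le _ _ ht.1, variationOnFromTo.eq_of_le _ _ ht.1,
      inter_eq_right.2 (Icc_subset_Icc_right ht.2),
      inter_eq_right.2 (Icc_subset_Icc_right (ht.2.trans hbc))]
  rw [h'.naturalParameterization_variationOnFromTo ht, variation_from_eq,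
    h.naturalParameterization_variationOnFromTo (hsub ht)]

theorem rayIntegral_comp_min_le_setLIntegral (σ : X → ℝ≥0∞) (hγ : LipschitzWith 1 γ) {L : ℝ}
    (hL : 0 ≤ L) : rayIntegral σ (fun t => γ (min t L)) ≤ ∫⁻ t in Icc 0 L, σ (γ t) := by
  set stopped : ℝ → X := fun t => γ (min t L)
  have hlip : LipschitzWith 1 stopped :=
    mul_one (1 : ℝ≥0) ▸ hγ.comp (LipschitzWith.id.min_const L)
  have le_of_le : ∀ T, 0 ≤ T → T ≤ L → lineIntegral σ stopped 0 T ≤ ∫⁻ t in Icc 0 L, σ (γ t) := by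
    intro T hT hTL
    calc lineIntegral σ stopped 0 T ≤ ∫⁻ t in Icc 0 T, σ (stopped t) :=
          lineIntegral_le_setLIntegral σ hT hlip.lipschitzOnWith
      _ ≤ ∫⁻ t in Icc 0 L, σ (stopped t) := lintegral_mono_set (Icc_subset_Icc_right hTL)
      _ = ∫⁻ t in Icc 0 L, σ (γ t) := setLIntegral_congr_fun measurableSet_Icc fun t ht => by
          simp only [stopped, min_eq_left ht.2]
  refine iSup_le fun T => ?_
  rcases le_total (T : ℝ) L with hTL | hLT
  · exact le_of_le T T.coe_nonneg hTL
  · have hrect := isRectifiableCurve_of_lipschitzOnWith T.coe_nonneg hlip.lipschitzOnWith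
    have hconst : EqOn stopped (fun _ => stopped L) (Icc L T) := fun t ht => by
      simp only [stopped, min_eq_right ht.1, min_self]
    rw [hrect.lineIntegral_eq_of_eqOn_const σ hL hLT hconst]
    exact le_of_le L hL le_rfl

theorem lineIntegral_mono {ρ σ : X → ℝ≥0∞} (h : ρ ≤ σ) (γ : ℝ → X) (a b : ℝ) :
    lineIntegral ρ γ a b ≤ lineIntegral σ γ a b :=
  lintegral_mono fun _ => h _

theorem rayIntegral_mono {ρ σ : X → ℝ≥0∞} (h : ρ ≤ σ) (γ : ℝ → X) :
    rayIntegral ρ γ ≤ rayIntegral σ γ :=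
  iSup_mono fun _ => lineIntegral_mono h _ _ _

theorem lineIntegral_const_mul {c : ℝ≥0∞} (hc : c ≠ ∞) (ρ : X → ℝ≥0∞) (γ : ℝ → X) (a b : ℝ) :
    lineIntegral (fun x => c * ρ x) γ a b = c * lineIntegral ρ γ a b :=
  lintegral_const_mul' _ _ hc

theorem rayIntegral_const_mul {c : ℝ≥0∞} (hc : c ≠ ∞) (ρ : X → ℝ≥0∞) (γ : ℝ → X) :
    rayIntegral (fun x => c * ρ x) γ = c * rayIntegral ρ γ := by
  simp only [rayIntegral, lineIntegral_const_mul hc, ENNReal.mul_iSup]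

theorem IsLocallyRectifiableRay.isRectifiableCurve (h : IsLocallyRectifiableRay γ)
    {T : ℝ} (hT : 0 ≤ T) : IsRectifiableCurve γ 0 T := by
  refine ⟨hT, h.continuousOn.mono Icc_subset_Ici_self, ?_⟩
  have := h.rectifiable 0 T self_mem_Ici hT
  rwa [inter_eq_right.2 Icc_subset_Ici_self] at this

theorem IsLengthSpace.isPreconnected_ball (h : IsLengthSpace X) (x : X) (r : ℝ) :
    IsPreconnected (Metric.ball x r) := by
  refine isPreconnected_of_forall x fun y hy => ?_
  have hxy : dist x y < r := Metric.mem_ball'.1 hy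
  obtain ⟨γ, hγ, h0, h1, hlen⟩ := h x y ((r - dist x y) / 2) (by linarith)
  refine ⟨γ '' Icc 0 1, ?_, ⟨0, by simp, h0⟩, ⟨1, by simp, h1⟩, isPreconnected_Icc.image γ hγ⟩
  rintro _ ⟨t, ht, rfl⟩
  have hdist := (eVariationOn.edist_le γ (left_mem_Icc.2 zero_le_one) ht).trans hlen
  rw [h0, edist_dist, ENNReal.ofReal_le_ofReal_iff
    (by linarith [dist_nonneg (x := x) (y := y)])] at hdist
  exact Metric.mem_ball'.2 (by linarith)

end Curves

section Potential

variable {X : Type*} [MetricSpace X]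

/-- The curves `c : ℝ → X` of speed at most one with `c 0 ∈ K`. Only the part on `[0, ∞)` matters;
curves on all of `ℝ` make shifting and reversing possible without changing the domain. -/
def lipschitzCurvesFrom (K : Set X) : Set C(ℝ, X) :=
  {c | LipschitzWith 1 c ∧ c 0 ∈ K}

/-- The `σ`-length of a shortest path from `K` to `x`: the infimum of `∫ σ(c(t)) dt` over the
curves `c` of speed at most one from `K` to `x`. Allowing speeds below one does not change the
infimum and makes the competitors a closed class. -/
noncomputable def potential (σ : X → ℝ≥0∞) (K : Set X) (x : X) : ℝ≥0∞ :=
  ⨅ (c ∈ lipschitzCurvesFrom K) (L : ℝ≥0) (_ : c L = x), ∫⁻ t in Icc 0 (L : ℝ), σ (c t)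

variable {σ : X → ℝ≥0∞} {K : Set X}

theorem potential_lt_iff {x : X} {s : ℝ≥0∞} :
    potential σ K x < s ↔
      ∃ c ∈ lipschitzCurvesFrom K, ∃ L : ℝ≥0, c L = x ∧ ∫⁻ t in Icc 0 (L : ℝ), σ (c t) < s := by
  simp only [potential, iInf_lt_iff, exists_prop]

theorem potential_le_setLIntegral {c : C(ℝ, X)} (hc : c ∈ lipschitzCurvesFrom K) (L : ℝ≥0) :
    potential σ K (c L) ≤ ∫⁻ t in Icc 0 (L : ℝ), σ (c t) :=
  iInf₂_le_of_le c hc <| iInf₂_le (κ := fun M : ℝ≥0 => c M = c L) L rfl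

theorem potential_eq_zero_of_mem {x : X} (hx : x ∈ K) : potential σ K x = 0 := by
  have hc : ContinuousMap.const ℝ x ∈ lipschitzCurvesFrom K := ⟨LipschitzWith.const' x, hx⟩
  simpa using potential_le_setLIntegral (σ := σ) hc 0

theorem potential_le_add_setLIntegral_Icc {c : ℝ → X} (hc : LipschitzWith 1 c) {s t : ℝ}
    (hst : s ≤ t) : potential σ K (c t) ≤ potential σ K (c s) + ∫⁻ r in Icc s t, σ (c r) := by
  conv_rhs => rw [potential]
  simp only [ENNReal.iInf_add]
  refine le_iInf₂ fun d hd => le_iInf₂ fun L hL => ?_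
  have hshift : LipschitzWith 1 fun r => c (r - (L - s)) := by
    simpa only [one_mul] using!
      hc.comp (LipschitzWith.of_edist_le fun x y => (edist_sub_right x y (L - s)).le)
  set e : ℝ → X := fun r => if r ≤ L then d r else c (r - (L - s))
  have he : LipschitzWith 1 e := lipschitzWith_ite_le hd.1 hshift (by simpa using hL)
  have e_eq_left : EqOn e d (Iic L) := fun r hr => if_pos hr
  have e_eq_right : EqOn e (fun r => c (r - (L - s))) (Ici L) := fun r hr => by
    rcases (mem_Ici.1 hr).eq_or_lt with rfl | hlt
    · simpa [e] using hL
    · exact if_neg hlt.not_ge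
  have he_mem : (⟨e, he.continuous⟩ : C(ℝ, X)) ∈ lipschitzCurvesFrom K :=
    ⟨he, mem_of_eq_of_mem (e_eq_left L.coe_nonneg) hd.2⟩
  have hLM : (L : ℝ) ≤ L + (t - s) := by linarith
  obtain ⟨M, hM⟩ : ∃ M : ℝ≥0, (M : ℝ) = L + (t - s) :=
    CanLift.prf (L + (t - s) : ℝ) (L.coe_nonneg.trans hLM)
  calc potential σ K (c t) = potential σ K (e M) := by
        rw [e_eq_right (hM ▸ hLM), hM]
        ring_nf
    _ ≤ ∫⁻ r in Icc 0 (M : ℝ), σ (e r) := potential_le_setLIntegral he_mem M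
    _ ≤ (∫⁻ r in Icc 0 (L : ℝ), σ (e r)) + ∫⁻ r in Icc (L : ℝ) (L + (t - s)), σ (e r) := by
        rw [hM, ← Icc_union_Icc_eq_Icc L.coe_nonneg hLM]
        exact lintegral_union_le _ _ _
    _ = (∫⁻ r in Icc 0 (L : ℝ), σ (d r)) +
          ∫⁻ r in Icc (L : ℝ) (L + (t - s)), σ (c (r - (L - s))) := by
        congr 1
        · exact setLIntegral_congr_fun measurableSet_Icc fun r hr =>
            congrArg σ (e_eq_left hr.2)
        · exact setLIntegral_congr_fun measurableSet_Icc fun r hr =>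
            congrArg σ (e_eq_right hr.1)
    _ = (∫⁻ r in Icc 0 (L : ℝ), σ (d r)) + ∫⁻ r in Icc s t, σ (c r) := by
        rw [setLIntegral_Icc_comp_sub_const fun r => σ (c r)]
        ring_nf

theorem potential_le_add_setLIntegral {c : ℝ → X} (hc : LipschitzWith 1 c) {a b s t : ℝ}
    (hs : s ∈ Icc a b) (ht : t ∈ Icc a b) :
    potential σ K (c t) ≤ potential σ K (c s) + ∫⁻ r in Icc a b, σ (c r) := by
  rcases le_total s t with hst | hts
  · exact (potential_le_add_setLIntegral_Icc hc hst).trans <|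
      add_le_add_right (lintegral_mono_set (Icc_subset_Icc hs.1 ht.2)) _
  · have hneg : LipschitzWith 1 fun r => c (-r) :=
      mul_one (1 : ℝ≥0) ▸ hc.comp LipschitzWith.id.neg
    have reversed := potential_le_add_setLIntegral_Icc (σ := σ) (K := K) hneg (neg_le_neg hts)
    rw [setLIntegral_Icc_comp_neg fun r => σ (c r)] at reversed
    simp only [neg_neg] at reversed
    exact reversed.trans <|
      add_le_add_right (lintegral_mono_set (Icc_subset_Icc ht.1 hs.2)) _

theorem IsRectifiableCurve.potential_le_add_lineIntegral {γ : ℝ → X} {a b s t : ℝ}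
    (h : IsRectifiableCurve γ a b) (hs : s ∈ Icc a b) (ht : t ∈ Icc a b) :
    potential σ K (γ t) ≤ potential σ K (γ s) + lineIntegral σ γ a b := by
  obtain ⟨L, c, hc, himage, hint⟩ := h.exists_lipschitzWith_lineIntegral_eq
  obtain ⟨s', hs', hcs⟩ := himage (mem_image_of_mem γ hs)
  obtain ⟨t', ht', hct⟩ := himage (mem_image_of_mem γ ht)
  rw [hint, ← hcs, ← hct]
  exact potential_le_add_setLIntegral hc hs' ht'

theorem IsRectifiableCurve.potential_eq_top_iff {γ : ℝ → X} {a b s t : ℝ}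
    (h : IsRectifiableCurve γ a b) (hfin : lineIntegral σ γ a b ≠ ∞) (hs : s ∈ Icc a b)
    (ht : t ∈ Icc a b) : potential σ K (γ s) = ∞ ↔ potential σ K (γ t) = ∞ := by
  have top_of_top : ∀ {s t : ℝ}, s ∈ Icc a b → t ∈ Icc a b → potential σ K (γ s) = ∞ →
      potential σ K (γ t) = ∞ := by
    intro s t hs ht htop
    have := h.potential_le_add_lineIntegral (σ := σ) (K := K) ht hs
    rw [htop, top_le_iff, ENNReal.add_eq_top] at this
    exact this.resolve_right hfin
  exact ⟨top_of_top hs ht, top_of_top ht hs⟩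

theorem le_potential_of_forall_le_rayIntegral {F : Set X} {M : ℝ≥0∞}
    (h : ∀ γ ∈ curvesToward K F, M ≤ rayIntegral σ γ) {x : X} (hx : x ∈ F) :
    M ≤ potential σ K x := by
  refine le_iInf₂ fun c hc => le_iInf₂ fun L hL => ?_
  set γ : ℝ → X := fun t => c (min t L)
  have hlip : LipschitzWith 1 γ := mul_one (1 : ℝ≥0) ▸ hc.1.comp (LipschitzWith.id.min_const _)
  have hγ : γ ∈ curvesToward K F := by
    refine ⟨⟨hlip.continuous.continuousOn, hlip.locallyBoundedVariationOn _⟩, ?_, L + 1,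
      by positivity, ?_⟩
    · simpa [γ] using hc.2
    · rintro _ ⟨t, ht, rfl⟩
      have hLt : (L : ℝ) ≤ t := by linarith [mem_Ioi.1 ht]
      simpa [γ, min_eq_right hLt, hL] using hx
  exact (h γ hγ).trans (rayIntegral_comp_min_le_setLIntegral σ hc.1 L.coe_nonneg)

theorem IsRectifiableCurve.lineIntegral_add_indicator_eq_top {γ : ℝ → X} {a b : ℝ}
    (hγ : IsRectifiableCurve γ a b) {N : Set X} (hN : ∀ x ∉ N, potential σ K x = ∞)
    (hnt : (γ '' Icc a b).Nontrivial) (hK : (γ '' Icc a b ∩ K).Nonempty) :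
    lineIntegral (σ + N.indicator fun _ => ∞) γ a b = ∞ := by
  obtain ⟨L, c, hc, himage, hline⟩ := hγ.exists_lipschitzWith_lineIntegral_eq
  obtain ⟨_, hx, hxK⟩ := hK
  obtain ⟨s, hs, rfl⟩ := himage hx
  by_contra hne
  have hσ : ∫⁻ t in Icc 0 (L : ℝ), σ (c t) ≠ ∞ := by
    rw [← hline]
    exact ne_top_of_le_ne_top hne (lineIntegral_mono le_self_add _ _ _)
  have hcN : ∀ t ∈ Icc 0 (L : ℝ), c t ∈ N := by
    intro t ht
    by_contra htN
    have := potential_le_add_setLIntegral (σ := σ) (K := K) hc hs ht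
    rw [hN _ htN, potential_eq_zero_of_mem hxK, zero_add, top_le_iff] at this
    exact hσ this
  have hL : (L : ℝ≥0∞) ≠ 0 := by
    intro hL
    rw [ENNReal.coe_eq_zero] at hL
    rw [hL, NNReal.coe_zero, Icc_self, image_singleton] at himage
    exact (hnt.mono himage).not_subsingleton subsingleton_singleton
  refine hne ((hline _).trans (top_le_iff.1 ?_))
  calc ∞ = ∫⁻ _ in Icc 0 (L : ℝ), ∞ := by
        rw [setLIntegral_const, Real.volume_Icc, sub_zero, ENNReal.ofReal_coe_nnreal,
          ENNReal.top_mul hL]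
    _ ≤ _ := setLIntegral_mono' measurableSet_Icc fun t ht => by
        rw [Pi.add_apply, indicator_of_mem (hcN t ht), add_top]

theorem isCompact_lipschitzCurvesFrom [ProperSpace X] (hK : IsCompact K) :
    IsCompact (lipschitzCurvesFrom K) := by
  refine ArzelaAscoli.isCompact_of_equicontinuous _ ?_ ?_
  · have hclosed : IsClosed {f : ℝ → X | LipschitzWith 1 f ∧ f 0 ∈ K} := by
      rw [ofPred_and]
      refine IsClosed.inter ?_ (hK.isClosed.preimage (continuous_apply 0))
      simp only [LipschitzWith, ofPred_forall]
      exact isClosed_iInter fun s => isClosed_iInter fun t =>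
        isClosed_le ((continuous_apply s).edist (continuous_apply t)) continuous_const
    have himage : ContinuousMap.toFun '' lipschitzCurvesFrom K =
        {f : ℝ → X | LipschitzWith 1 f ∧ f 0 ∈ K} :=
      Subset.antisymm (image_subset_iff.2 fun c hc => hc)
        fun f hf => ⟨⟨f, hf.1.continuous⟩, hf, rfl⟩
    have hpi : IsCompact (univ.pi fun t : ℝ => Metric.cthickening |t| K) :=
      isCompact_univ_pi fun t => hK.cthickening
    rw [himage]
    refine hpi.of_isClosed_subset hclosed fun f hf t _ => ?_
    refine Metric.mem_cthickening_of_dist_le _ _ _ _ hf.2 ?_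
    simpa using hf.1.dist_le_mul t 0
  · exact (LipschitzWith.uniformEquicontinuous _ 1 fun c => c.2.1).equicontinuous

variable [MeasurableSpace X]

-- The half-open interval makes `{(c, L) | t < L}` open, so its indicator is lower semicontinuous.
theorem lowerSemicontinuous_setLIntegral_Ico_comp [ProperSpace X] [BorelSpace X]
    (hσ : LowerSemicontinuous σ) :
    LowerSemicontinuous fun z : C(ℝ, X) × ℝ≥0 => ∫⁻ t in Ico 0 (z.2 : ℝ), σ (z.1 t) := by
  simp only [← lintegral_indicator measurableSet_Ico]
  refine lowerSemicontinuous_lintegral (fun z => ?_) fun t => ?_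
  · exact (hσ.measurable.comp z.1.continuous.measurable).indicator measurableSet_Ico
  · have hopen : IsOpen {z : C(ℝ, X) × ℝ≥0 | t < z.2} :=
      isOpen_lt continuous_const (NNReal.continuous_coe.comp continuous_snd)
    have hcomp : LowerSemicontinuous fun z : C(ℝ, X) × ℝ≥0 => σ (z.1 t) :=
      hσ.comp ((continuous_eval_const t).comp continuous_fst)
    by_cases ht : 0 ≤ t
    · have heq : (fun z : C(ℝ, X) × ℝ≥0 => (Ico 0 (z.2 : ℝ)).indicator (fun s => σ (z.1 s)) t) =
          {z : C(ℝ, X) × ℝ≥0 | t < z.2}.indicator fun z => σ (z.1 t) := by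
        ext z
        simp [indicator, ht]
      rw [heq]
      exact lowerSemicontinuous_indicator_of_isOpen hopen hcomp fun _ => zero_le
    · simpa [indicator, mem_Ico, ht] using lowerSemicontinuous_const

theorem measurable_potential [ProperSpace X] [BorelSpace X] (hσ : LowerSemicontinuous σ)
    (hK : IsCompact K) : Measurable (potential σ K) := by
  set near : ℕ → ℚ → Set (C(ℝ, X) × ℝ≥0) := fun M q =>
    (lipschitzCurvesFrom K ×ˢ Icc 0 (M : ℝ≥0)) ∩
      {z | ∫⁻ t in Ico 0 (z.2 : ℝ), σ (z.1 t) ≤ (Real.toNNReal q : ℝ≥0∞)}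
  have near_compact : ∀ M q, IsCompact (near M q) := fun M q =>
    ((isCompact_lipschitzCurvesFrom hK).prod isCompact_Icc).inter_right <|
      (lowerSemicontinuous_setLIntegral_Ico_comp hσ).isClosed_preimage _
  -- Sublevel sets are σ-compact: evaluation at the endpoint maps each `near M q` to a compact set.
  have sublevel_eq : ∀ s, {x | potential σ K x < s} =
      ⋃ (M : ℕ) (q : ℚ) (_ : (Real.toNNReal q : ℝ≥0∞) < s), (fun z => z.1 z.2) '' near M q := by
    intro s
    ext x
    simp only [mem_ofPred_eq, potential_lt_iff, mem_iUnion, ← restrict_Ico_eq_restrict_Icc]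
    constructor
    · rintro ⟨c, hc, L, rfl, hlt⟩
      obtain ⟨q, -, hq, hqs⟩ := ENNReal.lt_iff_exists_rat_btwn.1 hlt
      obtain ⟨M, hM⟩ := exists_nat_ge L
      exact ⟨M, q, hqs, (c, L), ⟨⟨hc, zero_le, hM⟩, hq.le⟩, rfl⟩
    · rintro ⟨M, q, hqs, ⟨c, L⟩, ⟨⟨hc, -⟩, hle⟩, rfl⟩
      exact ⟨c, hc, L, rfl, hle.trans_lt hqs⟩
  refine measurable_of_Iio fun s => ?_
  change MeasurableSet {x | potential σ K x < s}
  rw [sublevel_eq]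
  refine .iUnion fun M => .iUnion fun q => .iUnion fun _ => IsCompact.measurableSet ?_
  exact (near_compact M q).image (continuous_fst.eval (NNReal.continuous_coe.comp continuous_snd))

theorem isUpperGradient_toReal_potential (hσ : Measurable σ) (K : Set X) :
    IsUpperGradient (fun x => (potential σ K x).toReal) σ := by
  refine ⟨hσ, fun γ a b h => ?_⟩
  rcases eq_or_ne (lineIntegral σ γ a b) ∞ with hI | hI
  · exact hI ▸ le_top
  have ha : a ∈ Icc a b := left_mem_Icc.2 h.le
  have hb : b ∈ Icc a b := right_mem_Icc.2 h.le
  have htop := h.potential_eq_top_iff (K := K) hI ha hb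
  by_cases hUa : potential σ K (γ a) = ∞
  · simp [hUa, htop.1 hUa]
  have hUb : potential σ K (γ b) ≠ ∞ := fun hUb => hUa (htop.2 hUb)
  have upper := ENNReal.toReal_mono (ENNReal.add_ne_top.2 ⟨hUa, hI⟩)
    (h.potential_le_add_lineIntegral (K := K) ha hb)
  have lower := ENNReal.toReal_mono (ENNReal.add_ne_top.2 ⟨hUb, hI⟩)
    (h.potential_le_add_lineIntegral (K := K) hb ha)
  rw [ENNReal.toReal_add hUa hI] at upper
  rw [ENNReal.toReal_add hUb hI] at lower
  rw [← ofReal_norm, ENNReal.ofReal_le_iff_le_toReal hI, Real.norm_eq_abs, abs_sub_le_iff]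
  exact ⟨by linarith, by linarith⟩

theorem isUpperGradient_indicator_potential_eq_top (hσ : Measurable σ) (K : Set X) {ε : ℝ≥0∞}
    (hε₀ : ε ≠ 0) (hε : ε ≠ ∞) :
    IsUpperGradient ({x | potential σ K x = ∞}.indicator fun _ => 1) fun x => ε * σ x := by
  refine ⟨hσ.const_mul ε, fun γ a b h => ?_⟩
  rw [lineIntegral_const_mul hε]
  rcases eq_or_ne (lineIntegral σ γ a b) ∞ with hI | hI
  · rw [hI, ENNReal.mul_top hε₀]
    exact le_top
  · simp [indicator,
      h.potential_eq_top_iff (K := K) hI (left_mem_Icc.2 h.le) (right_mem_Icc.2 h.le)]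

end Potential

section Modulus

variable {X : Type*} [MetricSpace X] {K F : Set X}

theorem curvesToward_mono {F' : Set X} (h : F ⊆ F') :
    curvesToward K F ⊆ curvesToward K F' := fun _ ⟨hγ, hK, τ, hτ, hF⟩ =>
  ⟨hγ, hK, τ, hτ, hF.trans h⟩

theorem IsEnd.antitone {F K : ℕ → Set X} (h : IsEnd F K) : Antitone F :=
  antitone_nat_of_succ_le fun j => subset_closure.trans (h.closure_subset j)

variable [MeasurableSpace X] {μ : Measure X} {p : ℝ}

theorem modulus_mono {Γ Γ' : Set (ℝ → X)} (h : Γ ⊆ Γ') : modulus μ p Γ ≤ modulus μ p Γ' :=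
  iInf₂_mono fun _ _ => le_iInf fun hΓ' => iInf_le _ fun γ hγ => hΓ' γ (h hγ)

theorem modulus_lt_iff {Γ : Set (ℝ → X)} {t : ℝ≥0∞} :
    modulus μ p Γ < t ↔ ∃ ρ : X → ℝ≥0∞, Measurable ρ ∧ (∀ γ ∈ Γ, 1 ≤ rayIntegral ρ γ) ∧
      ∫⁻ x, ρ x ^ p ∂μ < t := by
  simp only [modulus, iInf_lt_iff, exists_prop]

theorem IsParabolicEnd.iInf_modulus_eq_zero {F K : ℕ → Set X} (hpar : IsParabolicEnd μ p F K)
    (hF : Antitone F) : ⨅ j, modulus μ p (curvesToward (K 0) (F j)) = 0 := by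
  by_contra hne
  exact hpar ⟨_, pos_iff_ne_zero.2 hne, tendsto_atTop_iInf fun _ _ hij =>
    modulus_mono (curvesToward_mono (hF hij))⟩

theorem exists_const_le_rayIntegral_of_modulus_eq_zero {ι : Type*} {Γ : ι → Set (ℝ → X)}
    (hp : 0 ≤ p) (hΓ : ⨅ i, modulus μ p (Γ i) = 0) {M ε : ℝ≥0∞} (hM : M ≠ ∞) (hε : ε ≠ 0) :
    ∃ (i : ι) (ρ : X → ℝ≥0∞), Measurable ρ ∧ (∀ γ ∈ Γ i, M ≤ rayIntegral ρ γ) ∧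
      ∫⁻ x, ρ x ^ p ∂μ ≤ ε := by
  have hMp : M ^ p ≠ ∞ := ENNReal.rpow_ne_top_of_nonneg hp hM
  obtain ⟨i, hi⟩ := iInf_lt_iff.1 (hΓ.trans_lt (ENNReal.div_pos hε hMp))
  obtain ⟨ρ, hρ, hadm, hlt⟩ := modulus_lt_iff.1 hi
  refine ⟨i, fun x => M * ρ x, hρ.const_mul M, fun γ hγ => ?_, ?_⟩
  · rw [rayIntegral_const_mul hM]
    exact le_mul_of_one_le_right' (hadm γ hγ)
  · rw [lintegral_const_mul_rpow hp hM]
    exact (mul_le_mul_right hlt.le _).trans ENNReal.mul_div_le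

theorem exists_lowerSemicontinuous_forall_nat_le_rayIntegral [BorelSpace X] [μ.WeaklyRegular]
    {ι : Type*} {Γ : ι → Set (ℝ → X)} (hp : 0 < p) (hΓ : ⨅ i, modulus μ p (Γ i) = 0) :
    ∃ σ : X → ℝ≥0∞, LowerSemicontinuous σ ∧ ∫⁻ x, σ x ^ p ∂μ < ∞ ∧
      ∀ M : ℕ, ∃ i, ∀ γ ∈ Γ i, M ≤ rayIntegral σ γ := by
  obtain ⟨ε, hε, hsum⟩ := ENNReal.exists_pos_sum_of_countable one_ne_zero ℕ
  choose i ρ hρ hadm hint using fun M : ℕ => exists_const_le_rayIntegral_of_modulus_eq_zero hp.le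
    hΓ (ENNReal.natCast_ne_top M) (ENNReal.coe_ne_zero.2 (hε M).ne')
  obtain ⟨σ, hσ, hρσ, hσint⟩ := exists_lowerSemicontinuous_ge_lintegral_rpow_lt_top hp hρ
    ((ENNReal.tsum_le_tsum hint).trans_lt (hsum.trans ENNReal.one_lt_top)).ne
  exact ⟨σ, hσ, hσint, fun M =>
    ⟨i M, fun γ hγ => (hadm M γ hγ).trans (rayIntegral_mono (hρσ M) γ)⟩⟩

theorem modulus_eq_zero_of_forall_rayIntegral_eq_top (hp : 0 < p) {ρ : X → ℝ≥0∞}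
    (hρ : Measurable ρ) (hint : ∫⁻ x, ρ x ^ p ∂μ ≠ ∞) {Γ : Set (ℝ → X)}
    (h : ∀ γ ∈ Γ, rayIntegral ρ γ = ∞) : modulus μ p Γ = 0 := by
  refine le_antisymm (le_of_forall_pos_lt_add' fun δ hδ => ?_) zero_le
  obtain ⟨ε, hε, hεδ⟩ := ENNReal.exists_nnreal_pos_mul_lt hint hδ.ne'
  have hεp : ((ε : ℝ≥0∞) ^ p⁻¹) ^ p = ε := ENNReal.rpow_inv_rpow hp.ne' _
  have hε_ne_top : (ε : ℝ≥0∞) ^ p⁻¹ ≠ ∞ :=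
    ENNReal.rpow_ne_top_of_nonneg (inv_nonneg.2 hp.le) ENNReal.coe_ne_top
  have hε_ne_zero : (ε : ℝ≥0∞) ^ p⁻¹ ≠ 0 :=
    (ENNReal.rpow_pos (ENNReal.coe_pos.2 hε) ENNReal.coe_ne_top).ne'
  refine modulus_lt_iff.2 ⟨fun x => ε ^ p⁻¹ * ρ x, hρ.const_mul _, fun γ hγ => ?_, ?_⟩
  · rw [rayIntegral_const_mul hε_ne_top, h γ hγ, ENNReal.mul_top hε_ne_zero]
    exact le_top
  · rwa [lintegral_const_mul_rpow hp.le hε_ne_top, hεp, zero_add]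

theorem isExceptional_of_ae_potential_eq_top (hp : 0 < p) {σ : X → ℝ≥0∞} (hσ : Measurable σ)
    (hint : ∫⁻ x, σ x ^ p ∂μ ≠ ∞) (htop : ∀ᵐ x ∂μ, potential σ K x = ∞) :
    IsExceptional μ p K := by
  set N : Set X := toMeasurable μ {x | potential σ K x ≠ ∞}
  have hN : MeasurableSet N := measurableSet_toMeasurable _ _
  have potential_eq_top : ∀ x ∉ N, potential σ K x = ∞ := fun x hx =>
    not_not.1 fun h => hx (subset_toMeasurable μ _ h)
  have hN_null : ∀ᵐ x ∂μ, x ∉ N := measure_eq_zero_iff_ae_notMem.1 <|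
    (measure_toMeasurable _).trans htop
  refine modulus_eq_zero_of_forall_rayIntegral_eq_top hp
    (hσ.add ((measurable_const (a := ∞)).indicator hN)) ?_ ?_
  · convert hint using 1
    refine lintegral_congr_ae ?_
    filter_upwards [hN_null] with x hx
    rw [Pi.add_apply, indicator_of_notMem hx, add_zero]
  · rintro γ ⟨hγ, ⟨_, ⟨s, hs, rfl⟩, _, ⟨t, ht, rfl⟩, hst⟩, ⟨_, ⟨r, hr, rfl⟩, hrK⟩⟩
    lift s to ℝ≥0 using hs
    lift t to ℝ≥0 using ht
    lift r to ℝ≥0 using hr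
    obtain ⟨T, ⟨hsT, htT⟩, hrT⟩ : ∃ T, (s ≤ T ∧ t ≤ T) ∧ r ≤ T :=
      ⟨max (max s t) r, max_le_iff.1 (le_max_left _ _), le_max_right _ _⟩
    refine top_le_iff.1 (le_iSup_of_le T (top_le_iff.2 ?_))
    exact (hγ.isRectifiableCurve T.coe_nonneg).lineIntegral_add_indicator_eq_top potential_eq_top
      ⟨_, mem_image_of_mem γ ⟨s.2, hsT⟩, _, mem_image_of_mem γ ⟨t.2, htT⟩, hst⟩
      ⟨_, mem_image_of_mem γ ⟨r.2, hrT⟩, hrK⟩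

end Modulus

section Poincare

variable {X : Type*} [MetricSpace X] [MeasurableSpace X] {μ : Measure X} {p r : ℝ}

/-- A `p`-Poincaré inequality on the balls of the one radius `r`. The constant `A` absorbs the
factor `r`, and the balls on the right have some fixed radius `R`. -/
def SatisfiesPoincareAtScale (μ : Measure X) (p r : ℝ) : Prop :=
  ∃ (A : ℝ≥0) (R : ℝ), 0 < R ∧ ∀ (x : X) (u : X → ℝ) (g : X → ℝ≥0∞), LocallyIntegrable u μ →
    IsUpperGradient u g →
      ⨍⁻ y in Metric.ball x r, ‖u y - ⨍ z in Metric.ball x r, u z ∂μ‖ₑ ∂μ ≤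
        A * (⨍⁻ y in Metric.ball x R, g y ^ p ∂μ) ^ (1 / p)

theorem UniformlyLocallyControlled.exists_satisfiesPoincareAtScale
    (h : UniformlyLocallyControlled μ p) : ∃ r, 0 < r ∧ SatisfiesPoincareAtScale μ p r := by
  obtain ⟨R₀, Cd, C, lam, hR₀, -, -, hlam, hctl⟩ := h
  obtain ⟨r, hr, hrR₀⟩ := ENNReal.lt_iff_exists_nnreal_btwn.1 hR₀
  have hr' : (0 : ℝ) < r := NNReal.coe_pos.2 (ENNReal.coe_pos.1 hr)
  refine ⟨r, hr', (C * r).toNNReal, lam * r, mul_pos hlam hr', fun x => ?_⟩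
  exact (hctl x r hr' (by rwa [ENNReal.ofReal_coe_nnreal])).2

theorem SatisfiesPoincareAtScale.exists_ae_restrict_ball_eq_const [ProperSpace X]
    [OpensMeasurableSpace X] [IsLocallyFiniteMeasure μ] [μ.IsOpenPosMeasure]
    (h : SatisfiesPoincareAtScale μ p r) (hp : 0 < p) {u : X → ℝ} (hu : LocallyIntegrable u μ)
    {g : X → ℝ≥0∞} (hg : ∫⁻ x, g x ^ p ∂μ ≠ ∞)
    (hug : ∀ ε : ℝ≥0, 0 < ε → IsUpperGradient u fun x => ε * g x) (x : X) :
    ∃ c, u =ᵐ[μ.restrict (Metric.ball x r)] fun _ => c := by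
  obtain ⟨A, R, hR, hPI⟩ := h
  set m := ⨍ z in Metric.ball x r, u z ∂μ
  set D : ℝ≥0∞ := A * (⨍⁻ y in Metric.ball x R, g y ^ p ∂μ) ^ (1 / p)
  have hp' : 0 ≤ 1 / p := one_div_nonneg.2 hp.le
  have hD : D ≠ ∞ := by
    refine ENNReal.mul_ne_top ENNReal.coe_ne_top (ENNReal.rpow_ne_top_of_nonneg hp' ?_)
    rw [setLAverage_eq]
    exact ENNReal.div_ne_top (ne_top_of_le_ne_top hg (setLIntegral_le_lintegral _ _))
      (Metric.measure_ball_pos μ x hR).ne'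
  have oscillation_le : ∀ ε : ℝ≥0, 0 < ε → ⨍⁻ y in Metric.ball x r, ‖u y - m‖ₑ ∂μ ≤ ε * D := by
    intro ε hε
    refine (hPI x u _ hu (hug ε hε)).trans_eq ?_
    rw [setLAverage_eq, lintegral_const_mul_rpow hp.le ENNReal.coe_ne_top, mul_div_assoc,
      ENNReal.mul_rpow_of_nonneg _ _ hp', one_div, ENNReal.rpow_rpow_inv hp.ne', mul_left_comm,
      ← setLAverage_eq, ← one_div]
  have oscillation_eq_zero : ⨍⁻ y in Metric.ball x r, ‖u y - m‖ₑ ∂μ = 0 := by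
    refine le_antisymm (le_of_forall_pos_lt_add' fun δ hδ => ?_) zero_le
    obtain ⟨ε, hε, hεδ⟩ := ENNReal.exists_nnreal_pos_mul_lt hD hδ.ne'
    exact (oscillation_le ε hε).trans_lt (by rwa [zero_add])
  rw [setLAverage_eq, ENNReal.div_eq_zero_iff, or_iff_left measure_ball_lt_top.ne,
    lintegral_eq_zero_iff'
      (hu.aestronglyMeasurable.aemeasurable.restrict.sub_const m).enorm] at oscillation_eq_zero
  exact ⟨m, oscillation_eq_zero.mono fun y hy => sub_eq_zero.1 (enorm_eq_zero.1 hy)⟩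

theorem exists_ae_eq_const_of_forall_ball [ConnectedSpace X] [SecondCountableTopology X]
    [OpensMeasurableSpace X] [μ.IsOpenPosMeasure] (hr : 0 < r) {β : Type*} {u : X → β}
    (h : ∀ x, ∃ c, u =ᵐ[μ.restrict (Metric.ball x r)] fun _ => c) :
    ∃ c, u =ᵐ[μ] fun _ => c := by
  choose c hc using h
  have hlocal : IsLocallyConstant c := by
    refine (IsLocallyConstant.iff_eventually_eq c).2 fun x => ?_
    filter_upwards [Metric.ball_mem_nhds x hr] with y hy
    have hne : μ (Metric.ball x r ∩ Metric.ball y r) ≠ 0 :=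
      ((Metric.isOpen_ball.inter Metric.isOpen_ball).measure_pos μ
        ⟨y, hy, Metric.mem_ball_self hr⟩).ne'
    have : (ae (μ.restrict (Metric.ball x r ∩ Metric.ball y r))).NeBot := ae_restrict_neBot.2 hne
    obtain ⟨z, hzx, hzy⟩ := ((ae_restrict_of_ae_restrict_of_subset inter_subset_left (hc x)).and
      (ae_restrict_of_ae_restrict_of_subset inter_subset_right (hc y))).exists
    exact hzy.symm.trans hzx
  obtain ⟨x₀⟩ : Nonempty X := inferInstance
  refine ⟨c x₀, measure_null_of_locally_null _ fun x _ => ?_⟩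
  refine ⟨{y | u y ≠ c x} ∩ Metric.ball x r, ?_, ?_⟩
  · rw [← hlocal.apply_eq_of_preconnectedSpace x x₀]
    exact inter_mem self_mem_nhdsWithin (mem_nhdsWithin_of_mem_nhds (Metric.ball_mem_nhds x hr))
  · rw [← Measure.restrict_apply' Metric.isOpen_ball.measurableSet]
    exact hc x

theorem ae_potential_ne_top_of_not_isExceptional [ProperSpace X] [ConnectedSpace X] [BorelSpace X]
    [IsLocallyFiniteMeasure μ] [μ.IsOpenPosMeasure] (hp : 0 < p) (hr : 0 < r)
    (hPoincare : SatisfiesPoincareAtScale μ p r) {σ : X → ℝ≥0∞} (hσ : LowerSemicontinuous σ)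
    (hint : ∫⁻ x, σ x ^ p ∂μ ≠ ∞) {K : Set X} (hK : IsCompact K) (hexc : ¬ IsExceptional μ p K) :
    ∀ᵐ x ∂μ, potential σ K x ≠ ∞ := by
  set u : X → ℝ := {x | potential σ K x = ∞}.indicator fun _ => 1
  have hu : LocallyIntegrable u μ :=
    (locallyIntegrable_const 1).indicator (measurable_potential hσ hK (measurableSet_singleton ∞))
  obtain ⟨c, hc⟩ := exists_ae_eq_const_of_forall_ball hr <|
    hPoincare.exists_ae_restrict_ball_eq_const hp hu hint fun ε hε =>
      isUpperGradient_indicator_potential_eq_top hσ.measurable K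
        (ENNReal.coe_ne_zero.2 hε.ne') ENNReal.coe_ne_top
  rcases eq_or_ne c 0 with rfl | hc0
  · filter_upwards [hc] with x hx htop
    simp [u, htop] at hx
  · refine absurd (isExceptional_of_ae_potential_eq_top hp hσ.measurable hint ?_) hexc
    filter_upwards [hc] with x hx
    change x ∈ {x | potential σ K x = ∞}
    exact mem_of_indicator_ne_zero (hx.trans_ne hc0)

end Poincare

section Volume

variable {X : Type*} [MetricSpace X] [MeasurableSpace X] {μ : Measure X} {r : ℝ}

theorem measure_eq_top_of_forall_exists_ball_subset [OpensMeasurableSpace X]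
    (hinf : 0 < ⨅ x : X, μ (Metric.ball x r)) {S : Set X} (x₀ : X)
    (h : ∀ R, ∃ x, R ≤ dist x x₀ ∧ Metric.ball x r ⊆ S) : μ S = ∞ := by
  by_contra hS
  have hmeas : ∀ n : ℕ, MeasurableSet (Metric.ball x₀ n)ᶜ := fun n =>
    Metric.isOpen_ball.measurableSet.compl
  have hanti : Antitone fun n : ℕ => (Metric.ball x₀ n)ᶜ := fun _ _ hmn =>
    compl_subset_compl.2 (Metric.ball_subset_ball (Nat.cast_le.2 hmn))
  have : IsFiniteMeasure (μ.restrict S) := isFiniteMeasure_restrict.2 hS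
  have hlim : Tendsto (fun n : ℕ => μ.restrict S (Metric.ball x₀ n)ᶜ) atTop (𝓝 0) := by
    have := tendsto_measure_iInter_atTop (fun n => (hmeas n).nullMeasurableSet) hanti
      ⟨0, measure_ne_top (μ.restrict S) _⟩
    rwa [← compl_iUnion, Metric.iUnion_ball_nat, compl_univ, measure_empty] at this
  refine hinf.not_ge (ge_of_tendsto' hlim fun n => ?_)
  obtain ⟨x, hx, hxS⟩ := h (n + r)
  have hdisj : Disjoint (Metric.ball x r) (Metric.ball x₀ n) :=
    Metric.ball_disjoint_ball (by linarith)
  rw [Measure.restrict_apply (hmeas n)]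
  exact (iInf_le _ x).trans (measure_mono (subset_inter hdisj.subset_compl_right hxS))

theorem IsLengthSpace.measure_connectedComponentIn_eq_top [OpensMeasurableSpace X]
    (hX : IsLengthSpace X) (hr : 0 < r) (hinf : 0 < ⨅ x : X, μ (Metric.ball x r)) {K : Set X}
    (hK : Bornology.IsBounded K) {x₀ : X}
    (hunb : ¬ Bornology.IsBounded (connectedComponentIn Kᶜ x₀)) :
    μ (connectedComponentIn Kᶜ x₀) = ∞ := by
  obtain ⟨ρ, hρ⟩ := hK.subset_ball x₀
  refine measure_eq_top_of_forall_exists_ball_subset hinf x₀ fun R => ?_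
  obtain ⟨x, hx, hfar⟩ : ∃ x ∈ connectedComponentIn Kᶜ x₀, max R (ρ + r) ≤ dist x x₀ := by
    by_contra! hnear
    exact hunb (Metric.isBounded_ball.subset hnear)
  refine ⟨x, (le_max_left _ _).trans hfar, ?_⟩
  have hdisj : Disjoint (Metric.ball x r) (Metric.ball x₀ ρ) :=
    Metric.ball_disjoint_ball (by linarith [le_max_right R (ρ + r)])
  rw [connectedComponentIn_eq hx]
  exact (hX.isPreconnected_ball x r).subset_connectedComponentIn (Metric.mem_ball_self hr)
    (hdisj.mono_right hρ).subset_compl_right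

theorem IsEnd.measure_eq_top [OpensMeasurableSpace X] {F K : ℕ → Set X} (hend : IsEnd F K)
    (hX : IsLengthSpace X) (hr : 0 < r) (hinf : 0 < ⨅ x : X, μ (Metric.ball x r)) (j : ℕ) :
    μ (F j) = ∞ := by
  obtain ⟨x, -, hF⟩ := hend.component j
  have hunb := hend.unbounded j
  rw [hF] at hunb ⊢
  exact hX.measure_connectedComponentIn_eq_top hr hinf (hend.isCompact j).isBounded hunb

theorem isLocallyFiniteMeasure_of_measure_ball_lt_top
    (h : ∀ x : X, ∃ r, 0 < r ∧ μ (Metric.ball x r) < ∞) : IsLocallyFiniteMeasure μ := by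
  refine ⟨fun x => ?_⟩
  obtain ⟨r, hr, hfin⟩ := h x
  exact ⟨_, Metric.ball_mem_nhds x hr, hfin⟩

theorem isOpenPosMeasure_of_measure_ball_pos
    (h : ∀ (x : X) (r : ℝ), 0 < r → 0 < μ (Metric.ball x r)) : μ.IsOpenPosMeasure := by
  refine ⟨fun U hU ⟨x, hx⟩ => ?_⟩
  obtain ⟨r, hr, hsub⟩ := Metric.isOpen_iff.1 hU x hx
  exact ((h x r hr).trans_le (measure_mono hsub)).ne'

theorem notMem_newtonClass_add_range_const {p : ℝ} (hp : 0 < p) {u : X → ℝ}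
    (hu : ∀ M : ℝ, ∃ S, μ S = ∞ ∧ ∀ᵐ x ∂μ, x ∈ S → M ≤ u x) :
    u ∉ newtonClass μ p + range (Function.const X : ℝ → X → ℝ) := by
  rintro ⟨v, ⟨⟨hv, -⟩, hint⟩, _, ⟨c, rfl⟩, rfl⟩
  obtain ⟨S, hS, hle⟩ := hu (c + 1)
  have one_le : ∀ᵐ x ∂μ, x ∈ S → 1 ≤ ‖v x‖ₑ ^ p := by
    filter_upwards [hle] with x hx hxS
    have hvx : 1 ≤ v x := by simpa [add_comm c] using hx hxS
    refine ENNReal.one_le_rpow ?_ hp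
    rw [← ofReal_norm, ENNReal.one_le_ofReal]
    exact hvx.trans (Real.le_norm_self _)
  have markov := mul_meas_ge_le_lintegral₀ (hv.enorm.pow_const p) 1
  rw [one_mul] at markov
  exact hint.not_ge (hS ▸ (measure_mono_ae one_le).trans markov)

end Volume

end NewtonSobolev

open NewtonSobolev in
theorem mainTheorem6_general {X : Type*} [MetricSpace X] [ProperSpace X] [ConnectedSpace X]
    [MeasurableSpace X] [BorelSpace X] {μ : Measure X} [IsLocallyFiniteMeasure μ]
    [μ.IsOpenPosMeasure] {p r : ℝ} (hp : 0 < p) (hr : 0 < r)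
    (hPoincare : SatisfiesPoincareAtScale μ p r) {K : Set X} (hK : IsCompact K)
    (hexc : ¬ IsExceptional μ p K) {ι : Type*} {F : ι → Set X} (hF : ∀ i, μ (F i) = ∞)
    (hmod : ⨅ i, modulus μ p (curvesToward K (F i)) = 0) :
    dirichletClass μ p ≠ newtonClass μ p + range (Function.const X : ℝ → X → ℝ) := by
  obtain ⟨σ, hσ, hint, hfar⟩ := exists_lowerSemicontinuous_forall_nat_le_rayIntegral hp hmod
  have potential_ne_top : ∀ᵐ x ∂μ, potential σ K x ≠ ∞ :=
    ae_potential_ne_top_of_not_isExceptional hp hr hPoincare hσ hint.ne hK hexc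
  have mem_dirichlet : (fun x => (potential σ K x).toReal) ∈ dirichletClass μ p :=
    ⟨(measurable_potential hσ hK).ennreal_toReal.aemeasurable, σ,
      isUpperGradient_toReal_potential hσ.measurable K, hint⟩
  refine fun heq => notMem_newtonClass_add_range_const hp (fun M => ?_) (heq ▸ mem_dirichlet)
  obtain ⟨n, hn⟩ := exists_nat_ge M
  obtain ⟨i, hi⟩ := hfar n
  refine ⟨F i, hF i, ?_⟩
  filter_upwards [potential_ne_top] with x hfin hx
  have hle : (n : ℝ≥0∞) ≤ potential σ K x := le_potential_of_forall_le_rayIntegral hi hx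
  exact hn.trans (by simpa using ENNReal.toReal_mono hfin hle)

open NewtonSobolev in
theorem mainTheorem6 {X : Type*} [MetricSpace X] [ProperSpace X] [ConnectedSpace X]
    [MeasurableSpace X] [BorelSpace X] (μ : Measure X) (p : ℝ) (hp : 1 ≤ p)
    (hμ : μ univ = ∞)
    (hball : ∀ (x : X) (r : ℝ), 0 < r → 0 < μ (Metric.ball x r) ∧ μ (Metric.ball x r) < ∞)
    (hcontrolled : NewtonSobolev.UniformlyLocallyControlled μ p)
    (hlength : NewtonSobolev.IsLengthSpace X)
    (hinf : 0 < ⨅ x : X, μ (Metric.ball x 1))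
    (F K : ℕ → Set X) (hend : NewtonSobolev.IsEnd F K)
    (hK : ¬ NewtonSobolev.IsExceptional μ p (K 0))
    (hparabolic : NewtonSobolev.IsParabolicEnd μ p F K) :
    NewtonSobolev.dirichletClass μ p ≠
      NewtonSobolev.newtonClass μ p + range (Function.const X : ℝ → X → ℝ) := by
  have := isLocallyFiniteMeasure_of_measure_ball_lt_top fun x => ⟨1, one_pos, (hball x 1 one_pos).2⟩
  have := isOpenPosMeasure_of_measure_ball_pos fun x r hr => (hball x r hr).1
  obtain ⟨r, hr, hPoincare⟩ := hcontrolled.exists_satisfiesPoincareAtScale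
  exact mainTheorem6_general (one_pos.trans_le hp) hr hPoincare (hend.isCompact 0) hK
    (hend.measure_eq_top hlength one_pos hinf) (hparabolic.iInf_modulus_eq_zero hend.antitone)
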